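/- Let $G$ be a simple undirected weighted graph on $V=\{1,\dots,n\}$, $n\ge 1$, not necessarily connected, in which every vertex has at least one neighbour. Each edge $ij$ has weight $w_{ij}=w_{ji}>0$, and $w_{ij}=0$ if $ij$ is not an edge. Let $W=(w_{ij})$, let $D$ be the diagonal matrix with $d_{ii}=\sum_j w_{ij}$, let $L=D-W$ be the graph Laplacian and $\mathcal{L}=D^{-1/2}LD^{-1/2}$ the normalized Laplacian. Let $W_L$ and $W_U$ be the strictly lower and strictly upper triangular parts of $W$. The iteration matrices of the Gauss–Seidel, SOR, Jacobi and JOR methods for $Lx=0$ are \[ H_{GS}=(D-W_L)^{-1}W_U,\qquad H_{SOR}=(D/\omega-W_L)^{-1}\bigl((1/\omega-1)D+W_U\bigr), \] \[ H_{JAC}=D^{-1}(W_L+W_U),\qquad H_{JOR}=(D/\omega)^{-1}\bigl((1/\omega-1)D+W_L+W_U\bigr). \] Call a real square matrix $A$ convergent if $\lim_{k\to\infty}A^k$ exists (the limit need not be zero), and let $\rho(A)$ denote its spectral radius, the largest modulus of its complex eigenvalues. Then $H_{GS}$, $H_{SOR}$ (for every real $\omega$ with $0<\omega<2$) and $H_{JOR}$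 (for every real $\omega$ with $0<\omega<2/\rho(\mathcal{L})$) are convergent, and each has spectral radius $1$. The matrix $H_{JAC}$ is convergent if and only if no connected component of $G$ is bipartite. -/

import Mathlib

open scoped ENNReal

/-- A simple undirected graph on the ordered vertex set `{0, …, n - 1}` with non-negative
symmetric edge weights; the edges are exactly the pairs of positive weight, so that
`weight i j = 0` whenever `ij` is not an edge. -/
structure WeightedGraph (n : ℕ) where
  graph : SimpleGraph (Fin n)
  weight : Fin n → Fin n → ℝ
  weight_symm : ∀ i j, weight i j = weight j i
  weight_nonneg : ∀ i j, 0 ≤ weight i j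
  adj_iff : ∀ i j, graph.Adj i j ↔ 0 < weight i j

namespace WeightedGraph

noncomputable section

variable {n : ℕ} (G : WeightedGraph n)

/-- The weighted adjacency matrix `W`. -/
def W : Matrix (Fin n) (Fin n) ℝ := Matrix.of G.weight

/-- The weighted degree `d_{ii} = ∑ j, w_{ij}`. -/
def deg (i : Fin n) : ℝ := ∑ j, G.weight i j

/-- The diagonal matrix `D` of the weighted degrees. -/
def D : Matrix (Fin n) (Fin n) ℝ := Matrix.diagonal G.deg

/-- The graph Laplacian `L = D - W`. -/
def L : Matrix (Fin n) (Fin n) ℝ := G.D - G.W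

/-- `D^{-1/2}`. -/
def DInvSqrt : Matrix (Fin n) (Fin n) ℝ := Matrix.diagonal fun i => (Real.sqrt (G.deg i))⁻¹

/-- The normalized Laplacian `D^{-1/2} L D^{-1/2}`. -/
def normL : Matrix (Fin n) (Fin n) ℝ := G.DInvSqrt * G.L * G.DInvSqrt

/-- The strictly lower triangular part of `W`. -/
def WL : Matrix (Fin n) (Fin n) ℝ := Matrix.of fun i j => if j < i then G.W i j else 0

/-- The strictly upper triangular part of `W`. -/
def WU : Matrix (Fin n) (Fin n) ℝ := Matrix.of fun i j => if i < j then G.W i j else 0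

/-- The Gauss–Seidel iteration matrix. -/
def HGS : Matrix (Fin n) (Fin n) ℝ := (G.D - G.WL)⁻¹ * G.WU

/-- The SOR iteration matrix with parameter `ω`. -/
def HSOR (ω : ℝ) : Matrix (Fin n) (Fin n) ℝ :=
  (ω⁻¹ • G.D - G.WL)⁻¹ * ((1 / ω - 1) • G.D + G.WU)

/-- The Jacobi iteration matrix. -/
def HJAC : Matrix (Fin n) (Fin n) ℝ := G.D⁻¹ * (G.WL + G.WU)

/-- The JOR (Jacobi over-relaxation) iteration matrix with parameter `ω`. -/
def HJOR (ω : ℝ) : Matrix (Fin n) (Fin n) ℝ :=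
  (ω⁻¹ • G.D)⁻¹ * ((1 / ω - 1) • G.D + G.WL + G.WU)

end

end WeightedGraph

/-- A real square matrix is convergent if the limit of its powers exists (not necessarily
zero). -/
def ConvergentMatrix {n : ℕ} (A : Matrix (Fin n) (Fin n) ℝ) : Prop :=
  ∃ B : Matrix (Fin n) (Fin n) ℝ, Filter.Tendsto (fun k : ℕ => A ^ k) Filter.atTop (nhds B)

/-- The spectral radius of a real square matrix: the largest modulus of its complex
eigenvalues. -/
noncomputable def matrixSpectralRadius {n : ℕ} (A : Matrix (Fin n) (Fin n) ℝ) : ℝ≥0∞ :=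
  spectralRadius ℂ (A.map ((↑) : ℝ → ℂ))

/-! Each method is a splitting `L = M - N` with iteration matrix `H = M⁻¹ N = 1 - M⁻¹ L`. Let `q x =
xᵀ L x ≥ 0` and `P = M + Mᵀ - L`. If `M y = L x`, then `H x = x - y` and `q (H x) = q x - yᵀ P y`.
When `P` is positive definite, `q x` is at most a multiple of `yᵀ P y`, so `q` decays geometrically
along the iteration. The increments `y` are controlled by `q`, so the iterates are Cauchy although
`L` is singular: `convergentMatrix_of_splitting`. Since `L` kills constants, `1` is an eigenvalue,
and convergence excludes larger moduli.

It remains to examine `P`: it is `(2/ω - 1) D` for SOR (Gauss–Seidel is `ω = 1`), `(2/ω) D - L` for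
JOR and `D + W` for Jacobi. The form of `D + W` is half the sum of `w_ij (x_i + x_j)²`, which
degenerates only on a bipartite component; such a component gives Jacobi the eigenvalue `-1`. -/

open Matrix Filter

/-! ### Convergence of splittings by energy decay -/

section Iteration

variable {n : ℕ}

/-- Every square matrix over a field is von Neumann regular. -/
theorem Matrix.exists_mul_mul_self_eq {K : Type*} [Field K] (A : Matrix (Fin n) (Fin n) K) :
    ∃ X : Matrix (Fin n) (Fin n) K, A * X * A = A := by
  set f := Matrix.toLin' A
  obtain ⟨g, hg⟩ := LinearMap.exists_rightInverse_of_surjective f.rangeRestrict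
    (LinearMap.range_rangeRestrict f)
  obtain ⟨g', hg'⟩ := LinearMap.exists_extend g
  refine ⟨LinearMap.toMatrix' g', ?_⟩
  apply Matrix.toLin'.injective
  rw [Matrix.toLin'_mul, Matrix.toLin'_mul, Matrix.toLin'_toMatrix']
  refine LinearMap.ext fun x => ?_
  have h1 : g' (f.rangeRestrict x : Fin n → K) = g (f.rangeRestrict x) :=
    LinearMap.congr_fun hg' (f.rangeRestrict x)
  have h2 := LinearMap.congr_fun hg (f.rangeRestrict x)
  have h3 : f (g (f.rangeRestrict x)) = f x :=
    congrArg Subtype.val h2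
  rw [← h1] at h3
  exact h3

/-- A quadratic form is dominated by a multiple of any positive definite one. -/
theorem exists_quadratic_le_mul (P R : Matrix (Fin n) (Fin n) ℝ)
    (hP : ∀ x : Fin n → ℝ, x ≠ 0 → 0 < x ⬝ᵥ P *ᵥ x) :
    ∃ C : ℝ, 1 ≤ C ∧ ∀ x : Fin n → ℝ, x ⬝ᵥ R *ᵥ x ≤ C * (x ⬝ᵥ P *ᵥ x) := by
  have hne : ∀ x ∈ Metric.sphere (0 : Fin n → ℝ) 1, x ≠ 0 := by
    rintro x hx rfl
    simp at hx
  have hcont : ∀ Q : Matrix (Fin n) (Fin n) ℝ, Continuous fun x : Fin n → ℝ => x ⬝ᵥ Q *ᵥ x :=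
    fun Q => continuous_id.dotProduct (continuous_const.matrix_mulVec continuous_id)
  obtain ⟨C, hC⟩ := (isCompact_sphere (0 : Fin n → ℝ) 1).exists_bound_of_continuousOn
    (f := fun x => (x ⬝ᵥ R *ᵥ x) / (x ⬝ᵥ P *ᵥ x))
    ((hcont R).continuousOn.div (hcont P).continuousOn fun x hx => (hP x (hne x hx)).ne')
  -- The constant is kept at least `1` so that `1 - C⁻¹` can serve as a contraction factor.
  refine ⟨max C 1, le_max_right _ _, fun x => ?_⟩
  by_cases hx : x = 0
  · simp [hx]
  have hpos : 0 < ‖x‖ := norm_pos_iff.2 hx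
  have hmem : ‖x‖⁻¹ • x ∈ Metric.sphere (0 : Fin n → ℝ) 1 := by
    simp [norm_smul, hpos.ne']
  have h := (le_abs_self _).trans ((hC _ hmem).trans (le_max_left C 1))
  have hx' := hP x hx
  simp only [mulVec_smul, dotProduct_smul, smul_dotProduct, smul_eq_mul] at h
  rw [mul_div_mul_left _ _ (by positivity), mul_div_mul_left _ _ (by positivity),
    div_le_iff₀ hx'] at h
  exact h

theorem isUnit_of_quadratic_pos {M : Matrix (Fin n) (Fin n) ℝ}
    (hM : ∀ x : Fin n → ℝ, x ≠ 0 → 0 < x ⬝ᵥ M *ᵥ x) : IsUnit M := by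
  rw [isUnit_iff_isUnit_det, isUnit_iff_ne_zero]
  intro h
  obtain ⟨v, hv, hv0⟩ := Matrix.exists_mulVec_eq_zero_iff.2 h
  simpa [hv0] using hM v hv

theorem dotProduct_transpose_mulVec_self (M : Matrix (Fin n) (Fin n) ℝ) (x : Fin n → ℝ) :
    x ⬝ᵥ Mᵀ *ᵥ x = x ⬝ᵥ M *ᵥ x := by
  rw [dotProduct_mulVec, vecMul_transpose, dotProduct_comm]

theorem convergentMatrix_of_forall_mulVec {H : Matrix (Fin n) (Fin n) ℝ}
    (h : ∀ x : Fin n → ℝ, ∀ i, ∃ a, Tendsto (fun k : ℕ => ((H ^ k) *ᵥ x) i) atTop (nhds a)) :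
    ConvergentMatrix H := by
  choose b hb using h
  refine ⟨Matrix.of fun i j => b (Pi.single j 1) i, ?_⟩
  refine tendsto_pi_nhds.2 fun i => tendsto_pi_nhds.2 fun j => ?_
  simpa using hb (Pi.single j 1) i

/-- A splitting `A = M - N` of a positive semidefinite matrix whose symmetrization `M + Mᵀ - A`
is positive definite defines a convergent iteration matrix `M⁻¹ N` (Keller). -/
theorem convergentMatrix_of_splitting {A M N : Matrix (Fin n) (Fin n) ℝ} (hN : N = M - A)
    (hA : Aᵀ = A) (hA0 : ∀ x : Fin n → ℝ, 0 ≤ x ⬝ᵥ A *ᵥ x)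
    (hP : ∀ x : Fin n → ℝ, x ≠ 0 → 0 < x ⬝ᵥ (M + Mᵀ - A) *ᵥ x) :
    IsUnit M ∧ ConvergentMatrix (M⁻¹ * N) := by
  have hM : IsUnit M := by
    refine isUnit_of_quadratic_pos fun x hx => ?_
    have h := hP x hx
    rw [sub_mulVec, add_mulVec, dotProduct_sub, dotProduct_add,
      dotProduct_transpose_mulVec_self] at h
    linarith [hA0 x]
  refine ⟨hM, ?_⟩
  have hdet : IsUnit M.det := (isUnit_iff_isUnit_det M).1 hM
  subst hN
  set H := M⁻¹ * (M - A) with hH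
  set q : (Fin n → ℝ) → ℝ := fun x => x ⬝ᵥ A *ᵥ x with hq
  set p : (Fin n → ℝ) → ℝ := fun x => x ⬝ᵥ (M + Mᵀ - A) *ᵥ x with hp
  have hAsymm : ∀ x y : Fin n → ℝ, x ⬝ᵥ A *ᵥ y = (A *ᵥ x) ⬝ᵥ y := fun x y => by
    rw [dotProduct_mulVec, ← mulVec_transpose, hA]
  have hstep : ∀ x, ∃ y, A *ᵥ x = M *ᵥ y ∧ H *ᵥ x = x - y := fun x => by
    refine ⟨M⁻¹ *ᵥ (A *ᵥ x), ?_, ?_⟩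
    · rw [mulVec_mulVec, mul_nonsing_inv _ hdet, one_mulVec]
    · rw [hH, Matrix.mul_sub, nonsing_inv_mul _ hdet, sub_mulVec, one_mulVec, mulVec_mulVec]
  have henergy : ∀ x y, A *ᵥ x = M *ᵥ y → q (x - y) = q x - p y := fun x y hxy => by
    simp only [hq, hp, sub_mulVec, add_mulVec, mulVec_sub, dotProduct_sub, dotProduct_add,
      sub_dotProduct, dotProduct_transpose_mulVec_self]
    rw [hAsymm x y, hxy, dotProduct_comm (M *ᵥ y) y]
    ring
  -- The generalized inverse `X` replaces `A⁻¹`: with `A x = M y`, it makes `q x` a quadratic form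
  -- in `y` alone.
  obtain ⟨X, hX⟩ := Matrix.exists_mul_mul_self_eq A
  obtain ⟨C, hC1, hC⟩ := exists_quadratic_le_mul (M + Mᵀ - A) (Mᵀ * X * M) hP
  obtain ⟨B, hB1, hB⟩ := exists_quadratic_le_mul (M + Mᵀ - A) 1 hP
  have hqp : ∀ x y, A *ᵥ x = M *ᵥ y → q x ≤ C * p y := fun x y hxy => by
    have : q x = y ⬝ᵥ (Mᵀ * X * M) *ᵥ y := by
      simp only [hq]
      conv_lhs => rw [← hX]
      rw [← mulVec_mulVec, ← mulVec_mulVec, ← mulVec_mulVec, ← mulVec_mulVec, hAsymm, hxy,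
        dotProduct_mulVec y Mᵀ, vecMul_transpose]
    exact this ▸ hC y
  have hcontr : ∀ x, q (H *ᵥ x) ≤ (1 - C⁻¹) * q x := fun x => by
    obtain ⟨y, hxy, hHx⟩ := hstep x
    rw [hHx, henergy x y hxy]
    have h := hqp x y hxy
    have : C⁻¹ * q x ≤ p y := by rwa [inv_mul_le_iff₀ (by linarith)]
    linarith
  have hr0 : 0 ≤ 1 - C⁻¹ := by
    have := inv_le_one_of_one_le₀ hC1
    linarith
  have hr1 : 1 - C⁻¹ < 1 := by
    have : 0 < C⁻¹ := by positivity
    linarith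
  have hgeom : ∀ x (k : ℕ), q ((H ^ k) *ᵥ x) ≤ (1 - C⁻¹) ^ k * q x := fun x k => by
    induction k with
    | zero => simp
    | succ k ih =>
      rw [pow_succ', ← mulVec_mulVec]
      calc q (H *ᵥ (H ^ k) *ᵥ x) ≤ (1 - C⁻¹) * q ((H ^ k) *ᵥ x) := hcontr _
        _ ≤ (1 - C⁻¹) * ((1 - C⁻¹) ^ k * q x) := mul_le_mul_of_nonneg_left ih hr0
        _ = _ := by ring
  refine convergentMatrix_of_forall_mulVec fun x i => cauchySeq_tendsto_of_complete ?_
  -- Square roots appear because the energy bounds the square of each increment.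
  refine cauchySeq_of_le_geometric (√(1 - C⁻¹)) (√(B * q x))
    (by rw [Real.sqrt_lt' one_pos]; simpa using hr1) fun k => ?_
  obtain ⟨y, hxy, hHx⟩ := hstep ((H ^ k) *ᵥ x)
  rw [pow_succ', ← mulVec_mulVec, hHx, Real.dist_eq, Pi.sub_apply, sub_sub_cancel]
  have hy : y i ^ 2 ≤ y ⬝ᵥ y := by
    rw [sq]
    exact Finset.single_le_sum (f := fun j => y j * y j) (fun j _ => mul_self_nonneg _)
      (Finset.mem_univ i)
  have h1 := hB y
  rw [one_mulVec] at h1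
  have h2 : p y ≤ q ((H ^ k) *ᵥ x) := by
    have h3 := henergy _ y hxy
    have h4 : 0 ≤ q ((H ^ k) *ᵥ x - y) := hA0 _
    linarith
  have h5 : y i ^ 2 ≤ B * q x * (1 - C⁻¹) ^ k := by
    calc y i ^ 2 ≤ B * p y := hy.trans h1
      _ ≤ B * ((1 - C⁻¹) ^ k * q x) :=
        mul_le_mul_of_nonneg_left (h2.trans (hgeom x k)) (by linarith)
      _ = _ := by ring
  calc |y i| ≤ √(B * q x * (1 - C⁻¹) ^ k) := Real.abs_le_sqrt h5
    _ = √(B * q x) * √(1 - C⁻¹) ^ k := by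
      rw [Real.sqrt_mul (mul_nonneg (by linarith) (hA0 x))]
      congr 1
      rw [Real.sqrt_eq_iff_mul_self_eq (by positivity) (by positivity), ← mul_pow,
        Real.mul_self_sqrt hr0]

/-! ### Spectral consequences of convergence -/

theorem exists_mulVec_eq_smul_of_mem_spectrum {A : Matrix (Fin n) (Fin n) ℂ} {z : ℂ}
    (hz : z ∈ spectrum ℂ A) : ∃ v : Fin n → ℂ, v ≠ 0 ∧ A *ᵥ v = z • v := by
  rw [← Matrix.spectrum_toLin', ← Module.End.hasEigenvalue_iff_mem_spectrum] at hz
  obtain ⟨v, hv⟩ := hz.exists_hasEigenvector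
  exact ⟨v, hv.2, by simpa using hv.apply_eq_smul⟩

theorem pow_mulVec_of_mulVec_eq_smul {K : Type*} [Field K] {A : Matrix (Fin n) (Fin n) K} {z : K}
    {v : Fin n → K} (h : A *ᵥ v = z • v) (k : ℕ) : (A ^ k) *ᵥ v = z ^ k • v := by
  induction k with
  | zero => simp
  | succ k ih => rw [pow_succ', ← mulVec_mulVec, ih, mulVec_smul, h, smul_smul, pow_succ]

theorem mem_spectrum_of_mulVec_eq_smul {K : Type*} [Field K] {A : Matrix (Fin n) (Fin n) K} {z : K}
    {v : Fin n → K} (hv : v ≠ 0) (h : A *ᵥ v = z • v) : z ∈ spectrum K A := by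
  rw [← Matrix.spectrum_toLin', ← Module.End.hasEigenvalue_iff_mem_spectrum]
  exact Module.End.hasEigenvalue_of_hasEigenvector
    ⟨Module.End.mem_eigenspace_iff.2 (by simpa using h), hv⟩

theorem map_ofReal_mulVec (A : Matrix (Fin n) (Fin n) ℝ) (v : Fin n → ℝ) :
    A.map ((↑) : ℝ → ℂ) *ᵥ (fun i => (v i : ℂ)) = fun i => ((A *ᵥ v) i : ℂ) := by
  ext i
  simp [mulVec, dotProduct]

/-- The powers of a convergent matrix converge over the complex numbers as well. -/
theorem ConvergentMatrix.exists_tendsto_map_mulVec {A : Matrix (Fin n) (Fin n) ℝ}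
    (hA : ConvergentMatrix A) (v : Fin n → ℂ) :
    ∃ b, Tendsto (fun k : ℕ => (A.map ((↑) : ℝ → ℂ) ^ k) *ᵥ v) atTop (nhds b) := by
  obtain ⟨B, hB⟩ := hA
  have hpow : ∀ k : ℕ, A.map ((↑) : ℝ → ℂ) ^ k = (A ^ k).map ((↑) : ℝ → ℂ) := fun k =>
    (map_pow (Complex.ofRealHom.mapMatrix (m := Fin n)) A k).symm
  simp only [hpow]
  have hcont : Continuous fun M : Matrix (Fin n) (Fin n) ℝ => M.map ((↑) : ℝ → ℂ) *ᵥ v :=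
    (continuous_id.matrix_map Complex.continuous_ofReal).matrix_mulVec continuous_const
  exact ⟨_, (hcont.tendsto B).comp hB⟩

/-- On an eigenvector the powers act by `z ^ k`, whose norm diverges when `1 < ‖z‖`. -/
theorem ConvergentMatrix.norm_le_one_of_mem_spectrum {A : Matrix (Fin n) (Fin n) ℝ}
    (hA : ConvergentMatrix A) {z : ℂ} (hz : z ∈ spectrum ℂ (A.map ((↑) : ℝ → ℂ))) : ‖z‖ ≤ 1 := by
  by_contra! hlt
  obtain ⟨v, hv, hAv⟩ := exists_mulVec_eq_smul_of_mem_spectrum hz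
  obtain ⟨b, hb⟩ := hA.exists_tendsto_map_mulVec v
  simp only [pow_mulVec_of_mulVec_eq_smul hAv] at hb
  have h1 := hb.norm
  simp only [norm_smul, norm_pow] at h1
  exact not_tendsto_nhds_of_tendsto_atTop
    ((tendsto_pow_atTop_atTop_of_one_lt hlt).atTop_mul_const (norm_pos_iff.2 hv)) _ h1

theorem le_matrixSpectralRadius {A : Matrix (Fin n) (Fin n) ℝ} {r : ℝ} {v : Fin n → ℝ}
    (hv : v ≠ 0) (h : A *ᵥ v = r • v) : ENNReal.ofReal r ≤ matrixSpectralRadius A := by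
  have hmem : (r : ℂ) ∈ spectrum ℂ (A.map ((↑) : ℝ → ℂ)) := by
    refine mem_spectrum_of_mulVec_eq_smul (v := fun i => (v i : ℂ)) ?_ ?_
    · exact fun h0 => hv (funext fun i => by simpa using congrFun h0 i)
    · rw [map_ofReal_mulVec, h]
      ext i
      simp
  refine le_trans ?_ (le_iSup₂ (f := fun z (_ : z ∈ spectrum ℂ (A.map ((↑) : ℝ → ℂ))) =>
    (‖z‖₊ : ℝ≥0∞)) (r : ℂ) hmem)
  rw [← ENNReal.ofReal_coe_nnreal]
  refine ENNReal.ofReal_le_ofReal ?_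
  simpa using le_abs_self r

theorem ConvergentMatrix.matrixSpectralRadius_eq_one {A : Matrix (Fin n) (Fin n) ℝ}
    (hA : ConvergentMatrix A) {v : Fin n → ℝ} (hv : v ≠ 0) (h : A *ᵥ v = v) :
    matrixSpectralRadius A = 1 := by
  apply le_antisymm
  · refine iSup₂_le fun z hz => ?_
    exact_mod_cast hA.norm_le_one_of_mem_spectrum hz
  · simpa using le_matrixSpectralRadius (r := 1) hv (by simpa using h)

/-- The iterates alternate between `v` and `-v`, so a limit must equal its own negative. -/
theorem ConvergentMatrix.eq_zero_of_mulVec_eq_neg {A : Matrix (Fin n) (Fin n) ℝ}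
    (hA : ConvergentMatrix A) {v : Fin n → ℝ} (h : A *ᵥ v = -v) : v = 0 := by
  obtain ⟨B, hB⟩ := hA
  have hcont : Continuous fun M : Matrix (Fin n) (Fin n) ℝ => M *ᵥ v :=
    continuous_id.matrix_mulVec continuous_const
  have hlim := (hcont.tendsto B).comp hB
  have hpow : ∀ k : ℕ, (A ^ k) *ᵥ v = (-1 : ℝ) ^ k • v :=
    pow_mulVec_of_mulVec_eq_smul (by simpa using h)
  have heven := hlim.comp (tendsto_id.const_mul_atTop' (r := 2) two_pos)
  have h1 : B *ᵥ v = v :=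
    tendsto_nhds_unique heven (by simp [Function.comp_def, hpow, pow_mul])
  have h2 : B *ᵥ v = -(B *ᵥ v) :=
    tendsto_nhds_unique (hlim.comp (tendsto_add_atTop_nat 1))
      (hlim.neg.congr fun k => by
        simp [pow_succ, ← mulVec_mulVec, h, mulVec_neg])
  rw [h1] at h2
  exact self_eq_neg.1 h2

end Iteration

/-! ### Quadratic forms of a weighted graph -/

namespace WeightedGraph

variable {n : ℕ} (G : WeightedGraph n)

theorem weight_self (i : Fin n) : G.weight i i = 0 := by
  have h : ¬ 0 < G.weight i i := fun h => G.graph.loopless.irrefl i ((G.adj_iff i i).2 h)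
  exact le_antisymm (not_lt.1 h) (G.weight_nonneg i i)

theorem weight_eq_zero_or_adj (i j : Fin n) : G.weight i j = 0 ∨ G.graph.Adj i j := by
  rw [G.adj_iff, or_comm, eq_comm]
  exact (G.weight_nonneg i j).lt_or_eq

theorem WL_add_WU : G.WL + G.WU = G.W := by
  ext i j
  rcases lt_trichotomy i j with h | rfl | h
  · simp [WL, WU, h, h.not_gt]
  · simp [WL, WU, W, weight_self]
  · simp [WL, WU, h, h.not_gt]

theorem transpose_W : G.Wᵀ = G.W := by
  ext i j
  exact G.weight_symm j i

theorem transpose_WL : G.WLᵀ = G.WU := by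
  ext i j
  simp [WL, WU, W, G.weight_symm j i]

theorem transpose_D : G.Dᵀ = G.D := diagonal_transpose _

theorem transpose_L : G.Lᵀ = G.L := by
  rw [L, transpose_sub, transpose_D, transpose_W]

theorem deg_pos (hG : ∀ i, ∃ j, G.graph.Adj i j) (i : Fin n) : 0 < G.deg i := by
  obtain ⟨j, hj⟩ := hG i
  exact ((G.adj_iff i j).1 hj).trans_le
    (Finset.single_le_sum (fun k _ => G.weight_nonneg i k) (Finset.mem_univ j))

theorem dotProduct_D_mulVec (x : Fin n → ℝ) :
    x ⬝ᵥ G.D *ᵥ x = ∑ i, G.deg i * x i ^ 2 := by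
  simp only [D, dotProduct, mulVec_diagonal]
  exact Finset.sum_congr rfl fun i _ => by ring

theorem dotProduct_W_mulVec (x : Fin n → ℝ) :
    x ⬝ᵥ G.W *ᵥ x = ∑ i, ∑ j, G.weight i j * (x i * x j) := by
  simp only [W, dotProduct, mulVec, of_apply, Finset.mul_sum]
  exact Finset.sum_congr rfl fun i _ => Finset.sum_congr rfl fun j _ => by ring

theorem dotProduct_D_mulVec_pos (hG : ∀ i, ∃ j, G.graph.Adj i j) {x : Fin n → ℝ} (hx : x ≠ 0) :
    0 < x ⬝ᵥ G.D *ᵥ x := by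
  obtain ⟨i, hi⟩ := Function.ne_iff.1 hx
  rw [dotProduct_D_mulVec]
  refine Finset.sum_pos' (fun j _ => mul_nonneg (G.deg_pos hG j).le (sq_nonneg _))
    ⟨i, Finset.mem_univ i, mul_pos (G.deg_pos hG i) (sq_pos_of_ne_zero hi)⟩

theorem two_mul_dotProduct_D_mulVec (x : Fin n → ℝ) :
    2 * (x ⬝ᵥ G.D *ᵥ x) = ∑ i, ∑ j, G.weight i j * (x i ^ 2 + x j ^ 2) := by
  have h1 : x ⬝ᵥ G.D *ᵥ x = ∑ i, ∑ j, G.weight i j * x i ^ 2 := by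
    simp only [dotProduct_D_mulVec, deg, Finset.sum_mul]
  have h2 : x ⬝ᵥ G.D *ᵥ x = ∑ i, ∑ j, G.weight i j * x j ^ 2 := by
    rw [h1, Finset.sum_comm]
    simp only [G.weight_symm]
  simp only [mul_add, Finset.sum_add_distrib]
  linarith

theorem two_mul_dotProduct_L_mulVec (x : Fin n → ℝ) :
    2 * (x ⬝ᵥ G.L *ᵥ x) = ∑ i, ∑ j, G.weight i j * (x i - x j) ^ 2 := by
  rw [L, sub_mulVec, dotProduct_sub, mul_sub, two_mul_dotProduct_D_mulVec, dotProduct_W_mulVec]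
  simp only [Finset.mul_sum, ← Finset.sum_sub_distrib]
  exact Finset.sum_congr rfl fun i _ => Finset.sum_congr rfl fun j _ => by ring

theorem two_mul_dotProduct_D_add_W_mulVec (x : Fin n → ℝ) :
    2 * (x ⬝ᵥ (G.D + G.W) *ᵥ x) = ∑ i, ∑ j, G.weight i j * (x i + x j) ^ 2 := by
  rw [add_mulVec, dotProduct_add, mul_add, two_mul_dotProduct_D_mulVec, dotProduct_W_mulVec]
  simp only [Finset.mul_sum, ← Finset.sum_add_distrib]
  exact Finset.sum_congr rfl fun i _ => Finset.sum_congr rfl fun j _ => by ring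

theorem dotProduct_L_mulVec_nonneg (x : Fin n → ℝ) : 0 ≤ x ⬝ᵥ G.L *ᵥ x := by
  have h : 0 ≤ 2 * (x ⬝ᵥ G.L *ᵥ x) := by
    rw [two_mul_dotProduct_L_mulVec]
    exact Finset.sum_nonneg fun i _ => Finset.sum_nonneg fun j _ =>
      mul_nonneg (G.weight_nonneg i j) (sq_nonneg _)
  linarith

theorem L_mulVec_one : G.L *ᵥ (1 : Fin n → ℝ) = 0 := by
  ext i
  rw [L, sub_mulVec, D, Pi.sub_apply, mulVec_diagonal]
  simp [W, mulVec, dotProduct, deg]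

/-! ### Gauss–Seidel, SOR and JOR -/

/-- A splitting of the graph Laplacian with positive definite symmetrization gives a convergent
iteration of spectral radius one. -/
theorem convergent_and_spectralRadius_of_splitting (hn : 0 < n) {M N : Matrix (Fin n) (Fin n) ℝ}
    (hN : N = M - G.L) (hP : ∀ x : Fin n → ℝ, x ≠ 0 → 0 < x ⬝ᵥ (M + Mᵀ - G.L) *ᵥ x) :
    ConvergentMatrix (M⁻¹ * N) ∧ matrixSpectralRadius (M⁻¹ * N) = 1 := by
  obtain ⟨hM, hconv⟩ :=
    convergentMatrix_of_splitting hN G.transpose_L G.dotProduct_L_mulVec_nonneg hP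
  refine ⟨hconv, hconv.matrixSpectralRadius_eq_one (v := 1) ?_ ?_⟩
  · exact fun h => one_ne_zero (congrFun h ⟨0, hn⟩)
  · rw [hN, Matrix.mul_sub, nonsing_inv_mul _ ((isUnit_iff_isUnit_det M).1 hM), sub_mulVec,
      ← mulVec_mulVec, L_mulVec_one, one_mulVec, mulVec_zero, sub_zero]

theorem HSOR_convergent (hn : 0 < n) (hG : ∀ i, ∃ j, G.graph.Adj i j) {ω : ℝ} (h0 : 0 < ω)
    (h2 : ω < 2) : ConvergentMatrix (G.HSOR ω) ∧ matrixSpectralRadius (G.HSOR ω) = 1 := by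
  refine G.convergent_and_spectralRadius_of_splitting hn ?_ fun x hx => ?_
  · rw [L, ← WL_add_WU, sub_smul, one_smul, one_div]
    abel
  · have h : ω⁻¹ • G.D - G.WL + (ω⁻¹ • G.D - G.WL)ᵀ - G.L = (2 / ω - 1) • G.D := by
      rw [transpose_sub, transpose_smul, transpose_D, transpose_WL, L, ← WL_add_WU, sub_smul,
        one_smul, div_eq_mul_inv, two_mul, add_smul]
      abel
    rw [h, smul_mulVec, dotProduct_smul, smul_eq_mul]
    refine mul_pos ?_ (G.dotProduct_D_mulVec_pos hG hx)
    rw [sub_pos, lt_div_iff₀ h0]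
    linarith

theorem HSOR_one : G.HSOR 1 = G.HGS := by
  simp [HSOR, HGS]

theorem DInvSqrt_mulVec_sqrt (hG : ∀ i, ∃ j, G.graph.Adj i j) (x : Fin n → ℝ) :
    G.DInvSqrt *ᵥ (fun i => √(G.deg i) * x i) = x := by
  ext i
  rw [DInvSqrt, mulVec_diagonal, inv_mul_cancel_left₀ (Real.sqrt_ne_zero'.2 (G.deg_pos hG i))]

theorem isHermitian_normL : G.normL.IsHermitian := by
  rw [IsHermitian, conjTranspose_eq_transpose_of_trivial, normL, transpose_mul, transpose_mul,
    transpose_L, DInvSqrt, diagonal_transpose, Matrix.mul_assoc]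

/-- The normalized Laplacian form is bounded by its spectral radius. -/
theorem smul_D_sub_L_pos (hG : ∀ i, ∃ j, G.graph.Adj i j) {c : ℝ}
    (hc : matrixSpectralRadius G.normL < ENNReal.ofReal c) {x : Fin n → ℝ} (hx : x ≠ 0) :
    0 < x ⬝ᵥ (c • G.D - G.L) *ᵥ x := by
  have hherm : (c • (1 : Matrix (Fin n) (Fin n) ℝ) - G.normL).IsHermitian := by
    refine IsHermitian.sub ?_ G.isHermitian_normL
    simp [IsHermitian]
  have hpos : (c • (1 : Matrix (Fin n) (Fin n) ℝ) - G.normL).PosDef := by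
    rw [hherm.posDef_iff_eigenvalues_pos]
    intro i
    -- An eigenvalue `μ ≤ 0` of `c • 1 - normL` would give `normL` the eigenvalue `c - μ ≥ c`, above
    -- its spectral radius.
    by_contra! hle
    have hv := hherm.mulVec_eigenvectorBasis i
    set v : Fin n → ℝ := (hherm.eigenvectorBasis i).ofLp
    have hv0 : v ≠ 0 := fun h => by
      have := hherm.eigenvectorBasis.orthonormal.ne_zero i
      exact this (by ext j; exact congrFun h j)
    have hev : G.normL *ᵥ v = (c - hherm.eigenvalues i) • v := by
      rw [sub_mulVec, smul_mulVec, one_mulVec] at hv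
      rw [sub_smul, ← hv, sub_sub_cancel]
    have h1 := le_matrixSpectralRadius hv0 hev
    have h2 := (ENNReal.ofReal_le_ofReal (by linarith : c ≤ c - hherm.eigenvalues i)).trans h1
    exact absurd hc h2.not_gt
  -- The substitution `z = D^{1/2} x` carries the form of `c • 1 - normL` to that of `c • D - L`.
  set z : Fin n → ℝ := fun i => √(G.deg i) * x i with hz
  have hzx : G.DInvSqrt *ᵥ z = x := G.DInvSqrt_mulVec_sqrt hG x
  have hz0 : z ≠ 0 := by
    intro h
    rw [h, mulVec_zero] at hzx
    exact hx hzx.symm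
  have h := (posDef_iff_dotProduct_mulVec.1 hpos).2 hz0
  have hL : z ⬝ᵥ G.normL *ᵥ z = x ⬝ᵥ G.L *ᵥ x := by
    rw [normL, ← mulVec_mulVec, ← mulVec_mulVec, hzx, dotProduct_mulVec, DInvSqrt,
      ← mulVec_transpose, diagonal_transpose, ← DInvSqrt, hzx]
  have hD : z ⬝ᵥ z = x ⬝ᵥ G.D *ᵥ x := by
    rw [dotProduct_D_mulVec, dotProduct]
    refine Finset.sum_congr rfl fun i _ => ?_
    rw [hz, mul_mul_mul_comm, Real.mul_self_sqrt (G.deg_pos hG i).le, sq]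
  rw [star_trivial, sub_mulVec, smul_mulVec, one_mulVec, dotProduct_sub, dotProduct_smul, hL,
    hD] at h
  rwa [sub_mulVec, smul_mulVec, dotProduct_sub, dotProduct_smul]

theorem HJOR_convergent (hn : 0 < n) (hG : ∀ i, ∃ j, G.graph.Adj i j) {ω : ℝ} (h0 : 0 < ω)
    (hω : ENNReal.ofReal ω < 2 / matrixSpectralRadius G.normL) :
    ConvergentMatrix (G.HJOR ω) ∧ matrixSpectralRadius (G.HJOR ω) = 1 := by
  refine G.convergent_and_spectralRadius_of_splitting hn ?_ fun x hx => ?_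
  · rw [L, ← WL_add_WU, sub_smul, one_smul, one_div]
    abel
  · have h : ω⁻¹ • G.D + (ω⁻¹ • G.D)ᵀ - G.L = (2 / ω) • G.D - G.L := by
      rw [transpose_smul, transpose_D, div_eq_mul_inv, two_mul, add_smul]
    rw [h]
    refine G.smul_D_sub_L_pos hG ?_ hx
    rw [ENNReal.ofReal_div_of_pos h0, ENNReal.ofReal_ofNat]
    have h3 : ENNReal.ofReal ω ≠ 0 := (ENNReal.ofReal_pos.2 h0).ne'
    rw [ENNReal.lt_div_iff_mul_lt (Or.inl h3) (Or.inl ENNReal.ofReal_ne_top), mul_comm]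
    exact ENNReal.mul_lt_of_lt_div hω

/-! ### Jacobi and bipartite components -/

/-- Every term `w_ab (x_a + x_b)²` vanishes, so `x` changes sign across each edge. It stays nonzero
throughout the component of `i`, where its sign is a 2-colouring. -/
theorem isBipartite_component_of_dotProduct_D_add_W_eq_zero {x : Fin n → ℝ}
    (h : x ⬝ᵥ (G.D + G.W) *ᵥ x ≤ 0) {i : Fin n} (hi : x i ≠ 0) :
    (G.graph.connectedComponentMk i).toSimpleGraph.IsBipartite := by
  have hedge : ∀ a b, G.graph.Adj a b → x a = -x b := fun a b hab => by
    have h2 : ∑ i, ∑ j, G.weight i j * (x i + x j) ^ 2 = 0 := by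
      refine le_antisymm ?_ ?_
      · rw [← two_mul_dotProduct_D_add_W_mulVec]
        linarith
      · exact Finset.sum_nonneg fun i _ => Finset.sum_nonneg fun j _ =>
          mul_nonneg (G.weight_nonneg i j) (sq_nonneg _)
    rw [Finset.sum_eq_zero_iff_of_nonneg fun i _ => Finset.sum_nonneg fun j _ =>
      mul_nonneg (G.weight_nonneg i j) (sq_nonneg _)] at h2
    have h3 := h2 a (Finset.mem_univ a)
    rw [Finset.sum_eq_zero_iff_of_nonneg fun j _ =>
      mul_nonneg (G.weight_nonneg a j) (sq_nonneg _)] at h3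
    have h4 := h3 b (Finset.mem_univ b)
    have h5 : (x a + x b) ^ 2 = 0 :=
      (mul_eq_zero.1 h4).resolve_left ((G.adj_iff a b).1 hab).ne'
    exact eq_neg_of_add_eq_zero_left (pow_eq_zero_iff two_ne_zero |>.1 h5)
  have hreach : ∀ a, G.graph.Reachable a i → x a ≠ 0 := by
    rintro a ⟨p⟩
    induction p with
    | nil => exact hi
    | cons hab _ ih => rw [hedge _ _ hab]; exact neg_ne_zero.2 (ih hi)
  refine ⟨SimpleGraph.Coloring.mk (fun v => if 0 < x v then 0 else 1) ?_⟩
  rintro ⟨a, ha⟩ ⟨b, hb⟩ hab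
  have hxab := hedge a b ((SimpleGraph.ConnectedComponent.toSimpleGraph_adj _ ha hb).1 hab)
  have hb0 : x b ≠ 0 := hreach b (SimpleGraph.ConnectedComponent.exact hb)
  simp only [hxab, Left.neg_pos_iff]
  rcases hb0.lt_or_gt with h | h <;> simp [h, h.not_gt]

theorem isUnit_det_D (hG : ∀ i, ∃ j, G.graph.Adj i j) : IsUnit G.D.det :=
  (isUnit_iff_isUnit_det _).1 (isUnit_of_quadratic_pos fun _ hx => G.dotProduct_D_mulVec_pos hG hx)

/-- The signed indicator of a bipartite component is an eigenvector of the Jacobi matrix for the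
eigenvalue `-1`. -/
theorem exists_HJAC_mulVec_eq_neg (hG : ∀ i, ∃ j, G.graph.Adj i j) {c : G.graph.ConnectedComponent}
    (hc : c.toSimpleGraph.IsBipartite) : ∃ v : Fin n → ℝ, v ≠ 0 ∧ G.HJAC *ᵥ v = -v := by
  classical
  obtain ⟨col⟩ := hc
  obtain ⟨i₀, hi₀⟩ := c.nonempty_supp
  set v : Fin n → ℝ := fun i => if h : i ∈ c.supp then (if col ⟨i, h⟩ = 0 then 1 else -1) else 0
    with hv
  have hedge : ∀ a b, G.graph.Adj a b → v b = -v a := fun a b hab => by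
    by_cases ha : a ∈ c.supp
    · have hb : b ∈ c.supp := c.mem_supp_of_adj_mem_supp ha hab
      have hne : col ⟨a, ha⟩ ≠ col ⟨b, hb⟩ :=
        col.valid ((SimpleGraph.ConnectedComponent.toSimpleGraph_adj c ha hb).2 hab)
      simp only [hv, ha, hb, dif_pos]
      split_ifs <;> first | omega | norm_num
    · have hb : b ∉ c.supp := fun hb => ha (c.mem_supp_of_adj_mem_supp hb hab.symm)
      simp only [hv, ha, hb, dif_neg, not_false_eq_true, neg_zero]
  refine ⟨v, fun h => ?_, ?_⟩
  · have h0 := congrFun h i₀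
    simp only [hv, hi₀, dif_pos, Pi.zero_apply] at h0
    split_ifs at h0 <;> norm_num at h0
  -- Every neighbour `j` of `i` has `v j = -v i`, so row `i` sums to `-deg i * v i`.
  · have hW : G.W *ᵥ v = G.D *ᵥ (-v) := by
      ext i
      rw [D, mulVec_diagonal, deg, Finset.sum_mul, mulVec, dotProduct]
      refine Finset.sum_congr rfl fun j _ => ?_
      rcases G.weight_eq_zero_or_adj i j with h | h
      · simp [W, h]
      · simp [W, hedge i j h]
    rw [HJAC, WL_add_WU, ← mulVec_mulVec, hW, mulVec_mulVec, nonsing_inv_mul _ (G.isUnit_det_D hG),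
      one_mulVec]

theorem HJAC_convergent_iff (hG : ∀ i, ∃ j, G.graph.Adj i j) :
    ConvergentMatrix G.HJAC ↔
      ∀ c : G.graph.ConnectedComponent, ¬ c.toSimpleGraph.IsBipartite := by
  refine ⟨fun hconv c hc => ?_, fun h => ?_⟩
  · obtain ⟨v, hv, hneg⟩ := G.exists_HJAC_mulVec_eq_neg hG hc
    exact hv (hconv.eq_zero_of_mulVec_eq_neg hneg)
  · refine (convergentMatrix_of_splitting (A := G.L) ?_ G.transpose_L
      G.dotProduct_L_mulVec_nonneg fun x hx => ?_).2
    · rw [L, WL_add_WU, sub_sub_cancel]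
    · obtain ⟨i, hi⟩ := Function.ne_iff.1 hx
      by_contra! hle
      -- For `M = D` the symmetrization `D + Dᵀ - L` is `D + W`.
      rw [transpose_D, L, add_sub_assoc, sub_sub_cancel] at hle
      exact h _ (G.isBipartite_component_of_dotProduct_D_add_W_eq_zero hle hi)

end WeightedGraph

theorem mainTheorem1 {n : ℕ} (hn : 0 < n) (G : WeightedGraph n)
    (hG : ∀ i, ∃ j, G.graph.Adj i j) :
    (ConvergentMatrix G.HGS ∧ matrixSpectralRadius G.HGS = 1) ∧
    (∀ ω : ℝ, 0 < ω → ω < 2 →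
      ConvergentMatrix (G.HSOR ω) ∧ matrixSpectralRadius (G.HSOR ω) = 1) ∧
    (∀ ω : ℝ, 0 < ω → ENNReal.ofReal ω < 2 / matrixSpectralRadius G.normL →
      ConvergentMatrix (G.HJOR ω) ∧ matrixSpectralRadius (G.HJOR ω) = 1) ∧
    (ConvergentMatrix G.HJAC ↔
      ∀ c : G.graph.ConnectedComponent, ¬ c.toSimpleGraph.IsBipartite) :=
  ⟨G.HSOR_one ▸ G.HSOR_convergent hn hG one_pos one_lt_two,
    fun _ h0 h2 => G.HSOR_convergent hn hG h0 h2,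
    fun _ h0 hω => G.HJOR_convergent hn hG h0 hω,
    G.HJAC_convergent_iff hG⟩
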